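/- Let $\mathbb{O}$ be the real octonions and $R=\mathbb{O}[y]$ the polynomial ring in a central indeterminate $y$. Let $\sigma$ be a unital $\mathbb{R}$-algebra endomorphism of $R$ with $\deg_y \sigma(y)>1$, and let $\delta:R\to R$ be an $\mathbb{R}$-linear map with $\delta(rs)=\sigma(r)\delta(s)+\delta(r)s$ for all $r,s\in R$. Let $S=R[x;\sigma,\delta]$ be the non-associative Ore extension: its elements are the polynomials $\sum_m r_m x^m$ with $r_m\in R$, added coefficientwise and multiplied by the biadditive product determined by $$(r x^m)(s x^n)=\sum_{i=0}^m \bigl(r\,\pi_i^m(s)\bigr)x^{i+n},$$ where $\pi_i^m$ is the sum of all $\binom{m}{i}$ compositions of $i$ copies of $\sigma$ and $m-i$ copies of $\delta$. Let $\chi(b)\in\mathbb{Z}\cup\{-\infty\}$ denote the degree of $b\in S$ in $x$, with $\chi(0)=-\infty$. Let $N(S)$ be the nucleus of $S$, that is, the set of all $u\in S$ with $(ub)c=u(bc)$, $(bu)c=b(uc)$ and $(bc)u=b(cu)$ for all $b,c\in S$, and for $a\in S$ let $C_S(a)=\{b\in S : ab=ba\}$. **Theorem.** Let $a\in S$ be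 an element with $\chi(a)>0$ all of whose coefficients (as a polynomial in $x$) lie in $\mathbb{R}\subset R$. Then: 1. $a\in N(S)$. 2. $\chi$ is a pseudo-degree function on $S$, that is, for all $b,c\in S$: $\chi(b)=-\infty$ if and only if $b=0$, $\chi(bc)=\chi(b)+\chi(c)$, and $\chi(b+c)\le\max(\chi(b),\chi(c))$. Moreover $C_S(a)$ satisfies condition $D(8)$ with respect to $\chi$: one has $\chi(b)\ge 0$ for every non-zero $b\in C_S(a)$, and whenever $b_1,\dots,b_9\in C_S(a)$ all have the same integer value under $\chi$, there are $\alpha_1,\dots,\alpha_9\in\mathbb{R}$, not all zero, with $\chi\bigl(\sum_{i=1}^9\alpha_i b_i\bigr)<\chi(b_1)$. 3. $C_S(a)$ is a free left $\mathbb{R}[a]$-module of finite rank, where $\mathbb{R}[a]$ is the (associative, commutative) unital $\mathbb{R}$-subalgebra of $S$ generated by $a$, acting by left multiplication. -/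

import Mathlib

noncomputable section

open scoped Quaternion

/-! ## Octonions -/

/-- The real octonions `𝕆`, obtained from the Hamilton quaternions by Cayley-Dickson doubling. -/
@[ext] structure Octonion : Type where
  fst : ℍ[ℝ]
  snd : ℍ[ℝ]

namespace Octonion

/-- An octonion is a pair of quaternions. -/
def equivProd : Octonion ≃ ℍ[ℝ] × ℍ[ℝ] where
  toFun p := (p.fst, p.snd)
  invFun p := ⟨p.1, p.2⟩

instance : AddCommGroup Octonion := equivProd.addCommGroup
instance : Module ℝ Octonion := equivProd.module ℝ

/-- The Cayley-Dickson product `(a, b) (c, d) = (a c - d̄ b, d a + b c̄)`. -/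
instance : Mul Octonion :=
  ⟨fun p q => ⟨p.fst * q.fst - star q.snd * p.snd, q.snd * p.fst + p.snd * star q.fst⟩⟩

instance : One Octonion := ⟨⟨1, 0⟩⟩

@[simp] theorem fst_zero : (0 : Octonion).fst = 0 := rfl
@[simp] theorem snd_zero : (0 : Octonion).snd = 0 := rfl
@[simp] theorem fst_add (p q : Octonion) : (p + q).fst = p.fst + q.fst := rfl
@[simp] theorem snd_add (p q : Octonion) : (p + q).snd = p.snd + q.snd := rfl
@[simp] theorem fst_smul (r : ℝ) (p : Octonion) : (r • p).fst = r • p.fst := rfl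
@[simp] theorem snd_smul (r : ℝ) (p : Octonion) : (r • p).snd = r • p.snd := rfl
@[simp] theorem fst_one : (1 : Octonion).fst = 1 := rfl
@[simp] theorem snd_one : (1 : Octonion).snd = 0 := rfl
@[simp] theorem fst_mul (p q : Octonion) : (p * q).fst = p.fst * q.fst - star q.snd * p.snd := rfl
@[simp] theorem snd_mul (p q : Octonion) : (p * q).snd = q.snd * p.fst + p.snd * star q.fst := rfl

instance : NonAssocRing Octonion where
  left_distrib p q r := by
    ext1
    · simp only [fst_mul, fst_add, snd_add, star_add, mul_add, add_mul]; abel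
    · simp only [snd_mul, fst_add, snd_add, star_add, mul_add, add_mul]; abel
  right_distrib p q r := by
    ext1
    · simp only [fst_mul, fst_add, snd_add, mul_add, add_mul]; abel
    · simp only [snd_mul, fst_add, snd_add, mul_add, add_mul]; abel
  zero_mul p := by ext1 <;> simp
  mul_zero p := by ext1 <;> simp
  one_mul p := by ext1 <;> simp
  mul_one p := by ext1 <;> simp

instance : IsScalarTower ℝ Octonion Octonion :=
  ⟨fun r p q => by
    simp only [smul_eq_mul]
    ext1 <;> simp [smul_sub, smul_add]⟩

instance : SMulCommClass ℝ Octonion Octonion :=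
  ⟨fun r p q => by
    simp only [smul_eq_mul]
    ext1 <;> simp [smul_sub, smul_add]⟩

end Octonion

/-! ## Polynomials in a central indeterminate over a non-associative ring -/

/-- The polynomial ring `R[y]` in one central indeterminate over a unital, not necessarily
associative ring `R`. -/
@[ext] structure NAPoly (R : Type*) [NonAssocRing R] where
  /-- the coefficients -/
  coeff : ℕ →₀ R

namespace NAPoly

variable {R : Type*} [NonAssocRing R]

/-- A polynomial is the finitely supported sequence of its coefficients. -/
def equivFinsupp : NAPoly R ≃ (ℕ →₀ R) where
  toFun := coeff
  invFun := mk

instance : AddCommGroup (NAPoly R) := equivFinsupp.addCommGroup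

/-- The monomial `r yⁿ`. -/
def monomial (n : ℕ) (r : R) : NAPoly R := ⟨Finsupp.single n r⟩

/-- `(∑ aₘ yᵐ) (∑ bₙ yⁿ) = ∑ aₘ bₙ yᵐ⁺ⁿ`. -/
instance : Mul (NAPoly R) :=
  ⟨fun f g => ⟨f.coeff.sum fun m a => g.coeff.sum fun n b => Finsupp.single (m + n) (a * b)⟩⟩

instance : One (NAPoly R) := ⟨monomial 0 1⟩

@[simp] theorem coeff_zero : (0 : NAPoly R).coeff = 0 := rfl
@[simp] theorem coeff_add (f g : NAPoly R) : (f + g).coeff = f.coeff + g.coeff := rfl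
@[simp] theorem coeff_one : (1 : NAPoly R).coeff = Finsupp.single 0 1 := rfl
@[simp] theorem coeff_monomial (n : ℕ) (r : R) :
    (monomial n r).coeff = Finsupp.single n r := rfl
theorem coeff_mul (f g : NAPoly R) : (f * g).coeff =
    f.coeff.sum fun m a => g.coeff.sum fun n b => Finsupp.single (m + n) (a * b) := rfl

instance : NonAssocRing (NAPoly R) where
  left_distrib f g h := by
    ext1
    simp only [coeff_mul, coeff_add]
    rw [← Finsupp.sum_add]
    refine Finsupp.sum_congr fun m _ => Finsupp.sum_add_index' ?_ ?_
    · intro n; simp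
    · intro n a b; rw [mul_add, Finsupp.single_add]
  right_distrib f g h := by
    ext1
    simp only [coeff_mul, coeff_add]
    refine Finsupp.sum_add_index' ?_ ?_
    · intro m; simp
    · intro m a b
      rw [← Finsupp.sum_add]
      exact Finsupp.sum_congr fun n _ => by rw [add_mul, Finsupp.single_add]
  zero_mul f := by ext1; simp [coeff_mul]
  mul_zero f := by ext1; simp [coeff_mul]
  one_mul f := by
    ext1
    rw [coeff_mul, coeff_one, Finsupp.sum_single_index (by simp)]
    simp only [zero_add, one_mul, Finsupp.sum_single]
  mul_one f := by
    ext1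
    rw [coeff_mul, coeff_one]
    refine (Finsupp.sum_congr fun m _ => ?_).trans (Finsupp.sum_single f.coeff)
    rw [Finsupp.sum_single_index (by simp), add_zero, mul_one]

variable {K : Type*} [CommRing K] [Module K R]

instance : Module K (NAPoly R) := equivFinsupp.module K

@[simp] theorem coeff_smul (c : K) (f : NAPoly R) : (c • f).coeff = c • f.coeff := rfl

instance [IsScalarTower K R R] : IsScalarTower K (NAPoly R) (NAPoly R) :=
  ⟨fun c f g => by
    ext1
    simp only [smul_eq_mul, coeff_mul, coeff_smul]
    rw [Finsupp.sum_smul_index' (by simp), Finsupp.smul_sum]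
    refine Finsupp.sum_congr fun m _ => ?_
    rw [Finsupp.smul_sum]
    exact Finsupp.sum_congr fun n _ => by rw [Finsupp.smul_single, smul_mul_assoc]⟩

instance [SMulCommClass K R R] : SMulCommClass K (NAPoly R) (NAPoly R) :=
  ⟨fun c f g => by
    ext1
    simp only [smul_eq_mul, coeff_mul, coeff_smul]
    rw [Finsupp.smul_sum]
    refine Finsupp.sum_congr fun m _ => ?_
    rw [Finsupp.smul_sum, Finsupp.sum_smul_index' (by simp)]
    exact Finsupp.sum_congr fun n _ => by rw [Finsupp.smul_single, mul_smul_comm]⟩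

/-- The indeterminate `y`. -/
def Y : NAPoly R := monomial 1 1

/-- The degree in `y`, equal to `-∞` (that is `⊥`) exactly at `0`. -/
def degree (f : NAPoly R) : WithBot ℤ :=
  f.coeff.support.sup fun n => ((n : ℤ) : WithBot ℤ)

end NAPoly

/-! ## Non-associative Ore extensions -/

/-- A unital `K`-algebra endomorphism `σ` of a not necessarily associative `K`-algebra `A`, together
with a `K`-linear `σ`-derivation `δ`. -/
structure OreDatum (K A : Type*) [CommRing K] [NonAssocRing A] [Module K A] where
  /-- the endomorphism -/
  σ : A →ₙₐ[K] A
  map_one : σ 1 = 1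
  /-- the `σ`-derivation -/
  δ : A →ₗ[K] A
  leibniz : ∀ r s : A, δ (r * s) = σ r * δ s + δ r * s

namespace OreDatum

variable {K A : Type*} [CommRing K] [NonAssocRing A] [Module K A] (D : OreDatum K A)

/-- `D.π m i` is the sum of all `m.choose i` compositions of `i` copies of `σ` and `m - i` copies
of `δ`, in any order. -/
def π : ℕ → ℕ → (A →ₗ[K] A)
  | 0, 0 => LinearMap.id
  | 0, _ + 1 => 0
  | m + 1, 0 => D.δ ∘ₗ π m 0
  | m + 1, i + 1 => (D.σ : A →ₗ[K] A) ∘ₗ π m i + D.δ ∘ₗ π m (i + 1)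

theorem δ_one : D.δ 1 = 0 := by
  have h := D.leibniz 1 1
  rw [D.map_one, one_mul, one_mul, mul_one] at h
  exact left_eq_add.mp h

theorem π_one (m i : ℕ) : D.π m i 1 = if i = m then 1 else 0 := by
  induction m generalizing i with
  | zero => cases i <;> simp [π]
  | succ m ih =>
    cases i with
    | zero =>
      rw [π, LinearMap.comp_apply, ih]
      split_ifs <;> simp_all [δ_one]
    | succ i =>
      have hσ : ∀ x, (D.σ : A →ₗ[K] A) x = D.σ x := fun _ => rfl
      rw [π, LinearMap.add_apply, LinearMap.comp_apply, LinearMap.comp_apply, ih, ih, hσ]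
      split_ifs <;> simp_all [δ_one, D.map_one]

end OreDatum

/-- The non-associative Ore extension `A[x; σ, δ]`: polynomials `∑ aₘ xᵐ` with coefficients in `A`
on the left, with the product determined by
`(a xᵐ) (b xⁿ) = ∑ᵢ (a π_i^m(b)) xⁱ⁺ⁿ`. -/
@[ext] structure OreExtension {K A : Type*} [CommRing K] [NonAssocRing A] [Module K A]
    (D : OreDatum K A) where
  /-- the (left) coefficients -/
  coeff : ℕ →₀ A

namespace OreExtension

variable {K A : Type*} [CommRing K] [NonAssocRing A] [Module K A] {D : OreDatum K A}

/-- An element is the finitely supported sequence of its coefficients. -/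
def equivFinsupp : OreExtension D ≃ (ℕ →₀ A) where
  toFun := coeff
  invFun := mk

instance : AddCommGroup (OreExtension D) := equivFinsupp.addCommGroup
instance : Module K (OreExtension D) := equivFinsupp.module K

instance : Mul (OreExtension D) :=
  ⟨fun f g => ⟨f.coeff.sum fun m a => g.coeff.sum fun n b =>
    ∑ i ∈ Finset.range (m + 1), Finsupp.single (i + n) (a * D.π m i b)⟩⟩

instance : One (OreExtension D) := ⟨⟨Finsupp.single 0 1⟩⟩

@[simp] theorem coeff_zero : (0 : OreExtension D).coeff = 0 := rfl
@[simp] theorem coeff_add (f g : OreExtension D) : (f + g).coeff = f.coeff + g.coeff := rfl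
@[simp] theorem coeff_smul (c : K) (f : OreExtension D) : (c • f).coeff = c • f.coeff := rfl
@[simp] theorem coeff_one : (1 : OreExtension D).coeff = Finsupp.single 0 1 := rfl
theorem coeff_mul (f g : OreExtension D) : (f * g).coeff =
    f.coeff.sum fun m a => g.coeff.sum fun n b =>
      ∑ i ∈ Finset.range (m + 1), Finsupp.single (i + n) (a * D.π m i b) := rfl

instance : NonAssocRing (OreExtension D) where
  left_distrib f g h := by
    ext1
    simp only [coeff_mul, coeff_add]
    rw [← Finsupp.sum_add]
    refine Finsupp.sum_congr fun m _ => Finsupp.sum_add_index' ?_ ?_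
    · intro n; simp
    · intro n a b
      rw [← Finset.sum_add_distrib]
      exact Finset.sum_congr rfl fun i _ => by rw [map_add, mul_add, Finsupp.single_add]
  right_distrib f g h := by
    ext1
    simp only [coeff_mul, coeff_add]
    refine Finsupp.sum_add_index' ?_ ?_
    · intro m; simp
    · intro m a b
      rw [← Finsupp.sum_add]
      refine Finsupp.sum_congr fun n _ => ?_
      rw [← Finset.sum_add_distrib]
      exact Finset.sum_congr rfl fun i _ => by rw [add_mul, Finsupp.single_add]
  zero_mul f := by ext1; simp [coeff_mul]
  mul_zero f := by ext1; simp [coeff_mul]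
  one_mul f := by
    ext1
    rw [coeff_mul, coeff_one, Finsupp.sum_single_index (by simp)]
    simp only [Finset.range_one, Finset.sum_singleton, zero_add, OreDatum.π, LinearMap.id_apply,
      one_mul, Finsupp.sum_single]
  mul_one f := by
    ext1
    rw [coeff_mul, coeff_one]
    refine (Finsupp.sum_congr fun m _ => ?_).trans (Finsupp.sum_single f.coeff)
    rw [Finsupp.sum_single_index (by simp), Finset.sum_eq_single m]
    · simp [OreDatum.π_one]
    · intro i _ hi; simp [OreDatum.π_one, hi]
    · intro h; simp at h

instance [IsScalarTower K A A] : IsScalarTower K (OreExtension D) (OreExtension D) :=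
  ⟨fun c f g => by
    ext1
    simp only [smul_eq_mul, coeff_mul, coeff_smul]
    rw [Finsupp.sum_smul_index' (by simp), Finsupp.smul_sum]
    refine Finsupp.sum_congr fun m _ => ?_
    rw [Finsupp.smul_sum]
    refine Finsupp.sum_congr fun n _ => ?_
    rw [Finset.smul_sum]
    exact Finset.sum_congr rfl fun i _ => by rw [Finsupp.smul_single, smul_mul_assoc]⟩

instance [SMulCommClass K A A] : SMulCommClass K (OreExtension D) (OreExtension D) :=
  ⟨fun c f g => by
    ext1
    simp only [smul_eq_mul, coeff_mul, coeff_smul]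
    rw [Finsupp.smul_sum]
    refine Finsupp.sum_congr fun m _ => ?_
    rw [Finsupp.smul_sum, Finsupp.sum_smul_index' (by simp)]
    refine Finsupp.sum_congr fun n _ => ?_
    rw [Finset.smul_sum]
    exact Finset.sum_congr rfl fun i _ => by rw [Finsupp.smul_single, map_smul, mul_smul_comm]⟩

/-- The degree in `x`, equal to `-∞` (that is `⊥`) exactly at `0`. -/
def degree (f : OreExtension D) : WithBot ℤ :=
  f.coeff.support.sup fun n => ((n : ℤ) : WithBot ℤ)

end OreExtension

/-! ## Nucleus, centralizers, pseudo-degree functions -/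

/-- The nucleus `N(S)`: the elements that associate with everything from the left, from the middle
and from the right. -/
def nucleus (S : Type*) [NonAssocRing S] : Subring S where
  carrier := {a | (∀ b c, (a * b) * c = a * (b * c)) ∧ (∀ b c, (b * a) * c = b * (a * c)) ∧
    (∀ b c, (b * c) * a = b * (c * a))}
  mul_mem' := by
    rintro a a' ⟨l, m, r⟩ ⟨l', m', r'⟩
    refine ⟨fun b c => ?_, fun b c => ?_, fun b c => ?_⟩
    · rw [l, l, l', ← l]
    · rw [← m, m', m, ← l]
    · rw [← r', r, r', r']
  one_mem' := by simp
  add_mem' := by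
    rintro a a' ⟨l, m, r⟩ ⟨l', m', r'⟩
    refine ⟨fun b c => ?_, fun b c => ?_, fun b c => ?_⟩
    · simp only [add_mul, l, l']
    · simp only [add_mul, mul_add, m, m']
    · simp only [mul_add, r, r']
  zero_mem' := by simp
  neg_mem' := by
    rintro a ⟨l, m, r⟩
    refine ⟨fun b c => ?_, fun b c => ?_, fun b c => ?_⟩
    · simp only [neg_mul, l]
    · simp only [neg_mul, mul_neg, m]
    · simp only [mul_neg, r]

section Centralizer

variable {K S : Type*} [CommRing K] [NonAssocRing S] [Module K S]

instance : Ring (nucleus S) where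
  mul_assoc a b c := Subtype.ext (a.2.1 _ _)

/-- `S` is a left module over its nucleus. -/
instance : Module (nucleus S) S where
  smul n s := n.1 * s
  one_smul s := one_mul s
  mul_smul n _ _ := n.2.1 _ _
  smul_zero _ := mul_zero _
  smul_add _ := mul_add _
  add_smul _ _ _ := add_mul _ _ _
  zero_smul s := zero_mul s

variable [IsScalarTower K S S] [SMulCommClass K S S]

instance : Module K (nucleus S) where
  smul c n := ⟨c • n.1, by
    obtain ⟨n, l, m, r⟩ := n
    refine ⟨fun b d => ?_, fun b d => ?_, fun b d => ?_⟩
    · simp only [smul_mul_assoc, l]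
    · simp only [smul_mul_assoc, mul_smul_comm, m]
    · simp only [mul_smul_comm, r]⟩
  one_smul n := Subtype.ext (one_smul _ _)
  mul_smul c d n := Subtype.ext (mul_smul _ _ _)
  smul_zero c := Subtype.ext (smul_zero _)
  smul_add c n n' := Subtype.ext (smul_add _ _ _)
  add_smul c d n := Subtype.ext (add_smul _ _ _)
  zero_smul n := Subtype.ext (zero_smul _ _)

instance : Algebra K (nucleus S) :=
  Algebra.ofModule (fun c n n' => Subtype.ext (smul_mul_assoc c n.1 n'.1))
    (fun c n n' => Subtype.ext (mul_smul_comm c n.1 n'.1))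

variable (K) in
/-- For `a` in the nucleus, the (associative) unital `K`-algebra `K[a]` generated by `a`. -/
def polyAlg (a : nucleus S) : Subalgebra K (nucleus S) := Algebra.adjoin K {a}

variable (K) in
/-- For `a` in the nucleus, the centralizer `C_S(a)` as a left `K[a]`-module, the action being left
multiplication in `S`. -/
def centralizerModule (a : nucleus S) : Submodule (polyAlg K a) S where
  carrier := Set.centralizer {(a : S)}
  add_mem' := Set.add_mem_centralizer
  zero_mem' := Set.zero_mem_centralizer
  smul_mem' := by
    rintro ⟨p, hp⟩ s hs
    simp only [Set.mem_centralizer_iff, Set.mem_singleton_iff, forall_eq] at hs ⊢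
    have hc : a * p = p * a :=
      (Algebra.commute_of_mem_adjoin_self hp).eq
    have hc' : (a : S) * p.1 = p.1 * a := congrArg Subtype.val hc
    change (a : S) * (p.1 * s) = (p.1 * s) * a
    rw [← a.2.1, hc', p.2.1, p.2.1, hs]

end Centralizer

/-- Pseudo-degree functions. -/
structure IsPseudoDegree {S : Type*} [NonAssocRing S] (χ : S → WithBot ℤ) : Prop where
  eq_bot_iff : ∀ a, χ a = ⊥ ↔ a = 0
  map_mul : ∀ a b, χ (a * b) = χ a + χ b
  map_add_le : ∀ a b, χ (a + b) ≤ max (χ a) (χ b)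

/-- Condition `D(ℓ)` for `B`, with respect to `χ`. -/
def ConditionD (K : Type*) {S : Type*} [CommRing K] [NonAssocRing S] [Module K S]
    (χ : S → WithBot ℤ) (ℓ : ℕ) (B : Set S) : Prop :=
  (∀ b ∈ B, b ≠ 0 → 0 ≤ χ b) ∧
  ∀ b : Fin (ℓ + 1) → S, (∀ i, b i ∈ B) → (∃ q : ℤ, ∀ i, χ (b i) = q) →
    ∃ α : Fin (ℓ + 1) → K, α ≠ 0 ∧ χ (∑ i, α i • b i) < χ (b 0)

end

/-! Everything rests on leading coefficients. An octonion is a real number plus an element with real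
square. Since `𝕆[y]` has no zero divisors, the image under `σ` of an element with real square again
has degree 0 or vanishes, so `σ` maps constants to constants (`topLE_σ_monomial_zero`); norms show
that it kills no non-zero one. Hence `σ` multiplies degrees in `y` by `d = deg σ(y) > 1`: it is
injective, which makes the degree in `x` additive, and the fixed points of `σ^m` with `m > 0` are
constants, an 8-dimensional space at most.

Let `a` have leading term `c x^m`. If `b` commutes with `a` and has degree `n`, the coefficients of
`x^(m+n)` in `ab = ba` give `σ^m(b_n) = b_n`. So all leading coefficients of the centralizer lie in
that space, and nine of them are dependent: this is `D(8)`.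

Let `L_q` be the space of coefficients at `x^q` of centralizer elements of degree at most `q`.
Multiplication by `c⁻¹ a` gives `L_q ≤ L_(q+m)`; by finite dimension these chains stabilize in each
residue class mod `m`. Beyond that point multiples of `a` cancel leading terms, so finitely many
elements of low degree generate the centralizer over `ℝ[a]`. This ring is a PID and the module is
torsion-free, hence free. All of this needs `a` in the nucleus, which follows from `X_mem_nucleus`.
-/

/-! ## Top coefficients of finitely supported sequences -/

namespace Finsupp

variable {M : Type*} [AddCommGroup M]

/-- All coefficients of `f` above `n` vanish. -/
def TopLE (f : ℕ →₀ M) (n : ℕ) : Prop := ∀ k, n < k → f k = 0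

/-- The coefficient of `f` at `n` is the last non-zero one. -/
def IsTop (f : ℕ →₀ M) (n : ℕ) : Prop := f.TopLE n ∧ f n ≠ 0

theorem TopLE.mono {f : ℕ →₀ M} {m n : ℕ} (h : f.TopLE m) (hmn : m ≤ n) : f.TopLE n :=
  fun k hk => h k (hmn.trans_lt hk)

theorem TopLE.add {f g : ℕ →₀ M} {n : ℕ} (hf : f.TopLE n) (hg : g.TopLE n) :
    (f + g).TopLE n := fun k hk => by rw [add_apply, hf k hk, hg k hk, add_zero]

theorem TopLE.le_of_mem_support {f : ℕ →₀ M} {n k : ℕ} (hf : f.TopLE n) (hk : k ∈ f.support) :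
    k ≤ n := by
  by_contra h
  exact mem_support_iff.mp hk (hf k (by omega))

theorem IsTop.unique {f : ℕ →₀ M} {m n : ℕ} (hm : f.IsTop m) (hn : f.IsTop n) : m = n := by
  by_contra h
  rcases Nat.lt_or_gt_of_ne h with h | h
  · exact hn.2 (hm.1 n h)
  · exact hm.2 (hn.1 m h)

theorem IsTop.ne_zero {f : ℕ →₀ M} {n : ℕ} (h : f.IsTop n) : f ≠ 0 := by
  rintro rfl
  exact h.2 rfl

theorem exists_isTop {f : ℕ →₀ M} (hf : f ≠ 0) : ∃ n, f.IsTop n := by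
  have hs : f.support.Nonempty := support_nonempty_iff.mpr hf
  refine ⟨f.support.max' hs, fun k hk => ?_, mem_support_iff.mp (f.support.max'_mem hs)⟩
  by_contra h
  exact absurd (f.support.le_max' k (mem_support_iff.mpr h)) (by omega)

theorem sup_support_eq_bot {f : ℕ →₀ M} :
    (f.support.sup fun n => ((n : ℤ) : WithBot ℤ)) = ⊥ ↔ f = 0 := by
  rw [Finset.sup_eq_bot_iff]
  constructor
  · intro h
    ext n
    by_contra hn
    exact WithBot.coe_ne_bot (h n (mem_support_iff.mpr hn))
  · rintro rfl
    simp

theorem IsTop.sup_support {f : ℕ →₀ M} {n : ℕ} (h : f.IsTop n) :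
    (f.support.sup fun n => ((n : ℤ) : WithBot ℤ)) = ((n : ℤ) : WithBot ℤ) := by
  refine le_antisymm (Finset.sup_le fun k hk => ?_)
    (Finset.le_sup (f := fun n : ℕ => ((n : ℤ) : WithBot ℤ)) (mem_support_iff.mpr h.2))
  exact WithBot.coe_le_coe.mpr (Int.ofNat_le.mpr (h.1.le_of_mem_support hk))

theorem isTop_of_sup_support {f : ℕ →₀ M} {q : ℤ}
    (h : (f.support.sup fun n => ((n : ℤ) : WithBot ℤ)) = (q : WithBot ℤ)) :
    ∃ n : ℕ, q = n ∧ f.IsTop n := by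
  have hf : f ≠ 0 := fun h0 => by
    rw [sup_support_eq_bot.mpr h0] at h
    exact WithBot.bot_ne_coe h
  obtain ⟨n, hn⟩ := exists_isTop hf
  exact ⟨n, by rw [hn.sup_support] at h; exact (WithBot.coe_inj.mp h).symm, hn⟩

theorem sup_support_lt {f : ℕ →₀ M} {n : ℕ} (h : f.TopLE n) (hn : f n = 0) :
    (f.support.sup fun n => ((n : ℤ) : WithBot ℤ)) < ((n : ℤ) : WithBot ℤ) := by
  rw [Finset.sup_lt_iff (WithBot.bot_lt_coe _)]
  intro k hk
  have hle := h.le_of_mem_support hk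
  have hne : k ≠ n := by
    rintro rfl
    exact mem_support_iff.mp hk hn
  exact WithBot.coe_lt_coe.mpr (Int.ofNat_lt.mpr (by omega))

end Finsupp

/-! ## The octonions -/

namespace Octonion

/-- Octonion conjugation. -/
def conj (p : Octonion) : Octonion := ⟨star p.fst, -p.snd⟩

/-- The squared norm. -/
def normSq (p : Octonion) : ℝ := Quaternion.normSq p.fst + Quaternion.normSq p.snd

/-- Moving `p` across without associativity: this gives both the absence of zero divisors and, with
`q = 1`, the inverse up to the norm. -/
theorem conj_mul_mul (p q : Octonion) : p.conj * (p * q) = p.normSq • q := by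
  have h1 : ∀ x y : Quaternion ℝ, star x * (x * y) = Quaternion.normSq x • y := fun x y => by
    rw [← mul_assoc, Quaternion.star_mul_self, Quaternion.coe_mul_eq_smul]
  have h2 : ∀ x y : Quaternion ℝ, y * star x * x = Quaternion.normSq x • y := fun x y => by
    rw [mul_assoc, Quaternion.star_mul_self, Quaternion.mul_coe_eq_smul]
  have h3 : ∀ x y : Quaternion ℝ, y * x * star x = Quaternion.normSq x • y := fun x y => by
    rw [mul_assoc, Quaternion.self_mul_star, Quaternion.mul_coe_eq_smul]
  have h4 : ∀ x y : Quaternion ℝ, x * (star x * y) = Quaternion.normSq x • y := fun x y => by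
    rw [← mul_assoc, Quaternion.self_mul_star, Quaternion.coe_mul_eq_smul]
  ext1
  · simp only [conj, normSq, fst_mul, snd_mul, star_add, star_mul, star_star, mul_sub,
      add_mul, mul_neg, h1, h2, add_smul, mul_assoc]
    rw [fst_add, fst_smul, fst_smul]
    abel
  · simp only [conj, normSq, fst_mul, snd_mul, star_sub, star_mul, star_star, mul_sub,
      add_mul, neg_mul, h3, h4, add_smul]
    rw [snd_add, snd_smul, snd_smul, mul_assoc p.snd]
    abel

theorem normSq_eq_zero {p : Octonion} : p.normSq = 0 ↔ p = 0 := by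
  constructor
  · intro h
    have h1 := Quaternion.normSq_nonneg (a := p.fst)
    have h2 := Quaternion.normSq_nonneg (a := p.snd)
    have h3 : Quaternion.normSq p.fst + Quaternion.normSq p.snd = 0 := h
    ext1
    · exact Quaternion.normSq_eq_zero.mp (by linarith)
    · exact Quaternion.normSq_eq_zero.mp (by linarith)
  · rintro rfl
    simp [normSq]

instance : NoZeroDivisors Octonion where
  eq_zero_or_eq_zero_of_mul_eq_zero {p q} h := by
    have h' := conj_mul_mul p q
    rw [h, mul_zero] at h'
    exact (smul_eq_zero.mp h'.symm).imp_left normSq_eq_zero.mp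

instance : Nontrivial Octonion := ⟨0, 1, fun h => zero_ne_one (congrArg fst h)⟩

/-- The underlying pair of quaternions, linearly. -/
def linearEquivProd : Octonion ≃ₗ[ℝ] Quaternion ℝ × Quaternion ℝ :=
  { equivProd with
    map_add' := fun _ _ => rfl
    map_smul' := fun _ _ => rfl }

theorem finrank_eq : Module.finrank ℝ Octonion = 8 := by
  rw [linearEquivProd.finrank_eq, Module.finrank_prod, Quaternion.finrank_eq_four]

instance : Module.Finite ℝ Octonion := Module.Finite.equiv linearEquivProd.symm

/-- Every octonion is the sum of a real number and an octonion whose square is real. -/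
theorem exists_eq_smul_one_add (p : Octonion) : ∃ (t s : ℝ) (q : Octonion),
    p = t • (1 : Octonion) + q ∧ q * q = s • (1 : Octonion) := by
  -- Real and imaginary parts: an imaginary `q` satisfies `q̄ = -q`, so its square is minus its
  -- norm.
  refine ⟨p.fst.re, -(Quaternion.normSq p.fst.im + Quaternion.normSq p.snd), ⟨p.fst.im, p.snd⟩,
    ?_, ?_⟩
  · ext1
    · rw [fst_add, fst_smul, fst_one, ← Quaternion.coe_mul_eq_smul, mul_one, Quaternion.re_add_im]
    · simp
  · have him : star p.fst.im = -p.fst.im := by ext <;> simp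
    ext1
    · rw [fst_mul, fst_smul, fst_one, ← Quaternion.coe_mul_eq_smul, mul_one, Quaternion.star_mul_self,
        ← neg_neg (p.fst.im * p.fst.im), ← neg_mul, ← him, Quaternion.star_mul_self]
      push_cast
      abel
    · rw [snd_mul, snd_smul, snd_one, him, mul_neg, smul_zero, add_neg_cancel]

end Octonion

/-! ## Degrees in polynomial rings over non-associative rings -/

namespace NAPoly

open Finsupp

variable {R : Type*} [NonAssocRing R]

theorem coeff_eq_zero {f : NAPoly R} : f.coeff = 0 ↔ f = 0 :=
  ⟨fun h => NAPoly.ext h, fun h => by rw [h, coeff_zero]⟩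

theorem coeff_mul_apply (f g : NAPoly R) (k : ℕ) : (f * g).coeff k =
    ∑ m ∈ f.coeff.support, ∑ n ∈ g.coeff.support,
      single (m + n) (f.coeff m * g.coeff n) k := by
  rw [coeff_mul, Finsupp.sum, finsetSum_apply]
  refine Finset.sum_congr rfl fun m _ => ?_
  rw [Finsupp.sum, finsetSum_apply]

theorem topLE_mul {f g : NAPoly R} {m n : ℕ} (hf : f.coeff.TopLE m) (hg : g.coeff.TopLE n) :
    (f * g).coeff.TopLE (m + n) := by
  intro k hk
  rw [coeff_mul_apply]
  refine Finset.sum_eq_zero fun i hi => Finset.sum_eq_zero fun j hj => single_eq_of_ne ?_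
  have := hf.le_of_mem_support hi
  have := hg.le_of_mem_support hj
  omega

theorem coeff_mul_add {f g : NAPoly R} {m n : ℕ} (hf : f.coeff.TopLE m) (hg : g.coeff.TopLE n) :
    (f * g).coeff (m + n) = f.coeff m * g.coeff n := by
  rw [coeff_mul_apply, Finset.sum_eq_single m, Finset.sum_eq_single n, single_eq_same]
  · intro j hj hne
    exact single_eq_of_ne (by omega)
  · intro h
    rw [notMem_support_iff.mp h, mul_zero, single_zero, coe_zero, Pi.zero_apply]
  · intro i hi hne
    refine Finset.sum_eq_zero fun j hj => single_eq_of_ne ?_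
    have := hf.le_of_mem_support hi
    have := hg.le_of_mem_support hj
    omega
  · intro h
    refine Finset.sum_eq_zero fun j _ => ?_
    rw [notMem_support_iff.mp h, zero_mul, single_zero, coe_zero, Pi.zero_apply]

theorem isTop_mul [NoZeroDivisors R] {f g : NAPoly R} {m n : ℕ} (hf : f.coeff.IsTop m)
    (hg : g.coeff.IsTop n) : (f * g).coeff.IsTop (m + n) :=
  ⟨topLE_mul hf.1 hg.1, by rw [coeff_mul_add hf.1 hg.1]; exact mul_ne_zero hf.2 hg.2⟩

instance [NoZeroDivisors R] : NoZeroDivisors (NAPoly R) where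
  eq_zero_or_eq_zero_of_mul_eq_zero {f g} h := by
    by_contra! hfg
    obtain ⟨m, hm⟩ := exists_isTop (mt coeff_eq_zero.mp hfg.1)
    obtain ⟨n, hn⟩ := exists_isTop (mt coeff_eq_zero.mp hfg.2)
    exact (isTop_mul hm hn).ne_zero (by rw [h, coeff_zero])

instance [Nontrivial R] : Nontrivial (NAPoly R) :=
  ⟨0, 1, fun h => one_ne_zero (single_eq_zero.mp (congrArg coeff h).symm)⟩

theorem monomial_mul_monomial (m n : ℕ) (r s : R) :
    monomial m r * monomial n s = monomial (m + n) (r * s) := by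
  ext1
  simp only [coeff_mul, coeff_monomial]
  rw [sum_single_index, sum_single_index] <;> simp

/-- Peeling off one `y` at a time on the right avoids bracketing powers of `σ(y)`. -/
theorem monomial_succ (n : ℕ) (r : R) : monomial (n + 1) r = monomial n r * Y := by
  rw [Y, monomial_mul_monomial, mul_one]

theorem monomial_add (n : ℕ) (r s : R) :
    monomial n (r + s) = monomial n r + monomial n s := by
  ext1
  simp

theorem monomial_zero (n : ℕ) : monomial n (0 : R) = 0 := by
  ext1
  simp

/-- The constant polynomials, linearly. -/
noncomputable def constant (K : Type*) [CommRing K] [Module K R] : R →ₗ[K] NAPoly R where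
  toFun := monomial 0
  map_add' := monomial_add 0
  map_smul' c r := by
    ext1
    simp

theorem eq_monomial_of_topLE_zero {f : NAPoly R} (h : f.coeff.TopLE 0) :
    f = monomial 0 (f.coeff 0) := by
  ext1
  ext n
  rcases n.eq_zero_or_pos with rfl | hn
  · simp
  · rw [h n hn, coeff_monomial, single_eq_of_ne (by omega)]

/-- A polynomial of degree at most `n + 1` is the sum of one of degree at most `n` and a
monomial. -/
theorem exists_eq_add_monomial {f : NAPoly R} {n : ℕ} (hf : f.coeff.TopLE (n + 1)) :
    ∃ g : NAPoly R, g.coeff.TopLE n ∧ f = g + monomial (n + 1) (f.coeff (n + 1)) := by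
  refine ⟨⟨f.coeff.erase (n + 1)⟩, fun k hk => ?_, ?_⟩
  · rcases eq_or_ne k (n + 1) with rfl | hne
    · exact erase_same
    · change (f.coeff.erase (n + 1)) k = 0
      rw [erase_ne hne, hf k (by omega)]
  · ext1
    rw [coeff_add, coeff_monomial, erase_add_single]

end NAPoly

namespace OreDatum

open NAPoly Finsupp

/-! ### Endomorphisms of the octonion polynomials -/

variable (D : OreDatum ℝ (NAPoly Octonion))

/-- If `σ(f)` has degree `n`, its square has degree `2n` but is a real constant, so `n = 0`. -/
theorem topLE_σ_of_sq {f : NAPoly Octonion} {s : ℝ} (h : f * f = s • 1) :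
    (D.σ f).coeff.TopLE 0 := by
  rcases eq_or_ne (D.σ f) 0 with h0 | h0
  · rw [h0]
    exact fun _ _ => rfl
  obtain ⟨n, hn⟩ := exists_isTop (mt coeff_eq_zero.mp h0)
  have hsq : D.σ f * D.σ f = s • 1 := by rw [← map_mul, h, map_smul, D.map_one]
  have htop := isTop_mul hn hn
  rw [hsq] at htop
  rcases n.eq_zero_or_pos with rfl | hpos
  · exact hn.1
  · refine absurd ?_ htop.2
    rw [coeff_smul, coeff_one, Finsupp.smul_apply, single_eq_of_ne (by omega), smul_zero]

theorem topLE_σ_monomial_zero (c : Octonion) : (D.σ (monomial 0 c)).coeff.TopLE 0 := by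
  obtain ⟨t, s, q, rfl, hq⟩ := c.exists_eq_smul_one_add
  have h1 : monomial 0 (t • (1 : Octonion)) = t • (1 : NAPoly Octonion) :=
    (constant ℝ).map_smul t 1
  rw [monomial_add, map_add, h1, map_smul, D.map_one, coeff_add]
  refine TopLE.add (fun k hk => ?_) (D.topLE_σ_of_sq (s := s) ?_)
  · rw [coeff_smul, coeff_one, Finsupp.smul_apply, single_eq_of_ne (by omega), smul_zero]
  · rw [monomial_mul_monomial, hq]
    exact (constant ℝ).map_smul s 1

/-- Applying `σ` to `c̄ c = |c|²` shows that `σ(c)` cannot vanish. -/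
theorem isTop_σ_monomial_zero {c : Octonion} (hc : c ≠ 0) :
    (D.σ (monomial 0 c)).coeff.IsTop 0 := by
  have h : D.σ (monomial 0 c) ≠ 0 := fun h0 => by
    have h1 : D.σ (monomial 0 c.conj * monomial 0 c) = c.normSq • 1 := by
      have h2 := c.conj_mul_mul 1
      rw [mul_one] at h2
      rw [monomial_mul_monomial, h2]
      have h3 : monomial 0 (c.normSq • (1 : Octonion)) = c.normSq • (1 : NAPoly Octonion) :=
        (constant ℝ).map_smul _ 1
      rw [h3, map_smul, D.map_one]
    rw [map_mul, h0, mul_zero] at h1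
    rcases smul_eq_zero.mp h1.symm with h4 | h4
    · exact hc (Octonion.normSq_eq_zero.mp h4)
    · exact one_ne_zero h4
  obtain ⟨n, hn⟩ := exists_isTop (mt coeff_eq_zero.mp h)
  rcases n.eq_zero_or_pos with rfl | hpos
  · exact hn
  · exact absurd (D.topLE_σ_monomial_zero c n hpos) hn.2

variable {D} {d : ℕ} (hd : (D.σ Y).coeff.IsTop d)
include hd

theorem isTop_σ_monomial (n : ℕ) {c : Octonion} (hc : c ≠ 0) :
    (D.σ (monomial n c)).coeff.IsTop (n * d) := by
  induction n with
  | zero => rw [zero_mul]; exact D.isTop_σ_monomial_zero hc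
  | succ n ih => rw [monomial_succ, map_mul, Nat.succ_mul]; exact isTop_mul ih hd

theorem topLE_σ {f : NAPoly Octonion} {n : ℕ} (hf : f.coeff.TopLE n) :
    (D.σ f).coeff.TopLE (n * d) := by
  induction n generalizing f with
  | zero =>
    rw [eq_monomial_of_topLE_zero hf, zero_mul]
    exact D.topLE_σ_monomial_zero _
  | succ n ih =>
    obtain ⟨g, hg, hfg⟩ := exists_eq_add_monomial hf
    rw [hfg, map_add]
    refine ((ih hg).mono (Nat.mul_le_mul_right d n.le_succ)).add ?_
    rcases eq_or_ne (f.coeff (n + 1)) 0 with h0 | h0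
    · rw [h0, monomial_zero, map_zero]
      exact fun _ _ => rfl
    · exact (isTop_σ_monomial hd (n + 1) h0).1

theorem isTop_σ (hpos : 0 < d) {f : NAPoly Octonion} {n : ℕ} (hf : f.coeff.IsTop n) :
    (D.σ f).coeff.IsTop (n * d) := by
  refine ⟨topLE_σ hd hf.1, ?_⟩
  cases n with
  | zero =>
    rw [eq_monomial_of_topLE_zero hf.1]
    simpa only [zero_mul] using (D.isTop_σ_monomial_zero hf.2).2
  | succ n =>
    obtain ⟨g, hg, hfg⟩ := exists_eq_add_monomial hf.1
    -- The lower part contributes degree at most `n * d`, strictly below `(n + 1) * d` because `d >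
    -- 0`.
    rw [hfg, map_add, coeff_add, Finsupp.add_apply, topLE_σ hd hg _ (by nlinarith), zero_add]
    exact (isTop_σ_monomial hd (n + 1) hf.2).2

theorem σ_injective (hpos : 0 < d) : Function.Injective D.σ := by
  refine (injective_iff_map_eq_zero D.σ).mpr fun f hf => ?_
  by_contra h
  obtain ⟨n, hn⟩ := exists_isTop (mt coeff_eq_zero.mp h)
  exact (isTop_σ hd hpos hn).ne_zero (by rw [hf, coeff_zero])

theorem isTop_σ_iterate (hpos : 0 < d) {f : NAPoly Octonion} {n : ℕ} (hf : f.coeff.IsTop n)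
    (m : ℕ) : (D.σ^[m] f).coeff.IsTop (n * d ^ m) := by
  induction m with
  | zero => simpa using hf
  | succ m ih =>
    rw [Function.iterate_succ_apply', pow_succ, ← mul_assoc]
    exact isTop_σ hd hpos ih

/-- The fixed points of a positive power of `σ` are constant when `σ` raises degrees. -/
theorem topLE_zero_of_σ_iterate_eq (h1 : 1 < d) {f : NAPoly Octonion} {m : ℕ} (hm : 0 < m)
    (hf : D.σ^[m] f = f) : f.coeff.TopLE 0 := by
  rcases eq_or_ne f 0 with rfl | h0
  · exact fun _ _ => rfl
  obtain ⟨n, hn⟩ := exists_isTop (mt coeff_eq_zero.mp h0)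
  have h := isTop_σ_iterate hd (by omega) hn m
  rw [hf] at h
  -- Comparing degrees, `n = n * d ^ m` with `d ^ m > 1`, which forces `n = 0`.
  have h2 := hn.unique h
  have h3 : 1 < d ^ m := Nat.one_lt_pow hm.ne' h1
  rcases n.eq_zero_or_pos with rfl | hpos
  · exact hn.1
  · nlinarith

end OreDatum

/-! ## Ore extensions: the nucleus and the degree -/

/-! ### The maps `π_i^m` -/

namespace OreDatum

variable {K A : Type*} [CommRing K] [NonAssocRing A] [Module K A] (D : OreDatum K A)

theorem π_of_lt {m i : ℕ} (h : m < i) (s : A) : D.π m i s = 0 := by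
  induction m generalizing i with
  | zero =>
    cases i with
    | zero => omega
    | succ i => rfl
  | succ m ih =>
    cases i with
    | zero => omega
    | succ i =>
      change D.σ (D.π m i s) + D.δ (D.π m (i + 1) s) = 0
      rw [ih (by omega), ih (by omega), map_zero, map_zero, add_zero]

theorem π_succ_succ (m i : ℕ) (s : A) :
    D.π (m + 1) (i + 1) s = D.σ (D.π m i s) + D.δ (D.π m (i + 1) s) := rfl

theorem π_succ_zero (m : ℕ) (s : A) : D.π (m + 1) 0 s = D.δ (D.π m 0 s) := rfl

theorem π_self (m : ℕ) (s : A) : D.π m m s = D.σ^[m] s := by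
  induction m with
  | zero => rfl
  | succ m ih =>
    rw [π_succ_succ, ih, π_of_lt D m.lt_succ_self, map_zero, add_zero,
      Function.iterate_succ_apply']

theorem π_succ_zero' (m : ℕ) (s : A) : D.π (m + 1) 0 s = D.π m 0 (D.δ s) := by
  induction m with
  | zero => rfl
  | succ m ih => rw [π_succ_zero, ih, π_succ_zero]

/-- The definition splits a word in `σ` and `δ` at its outermost letter; splitting at the innermost
one gives the same sum. -/
theorem π_succ_succ' (m i : ℕ) (s : A) :
    D.π (m + 1) (i + 1) s = D.π m i (D.σ s) + D.π m (i + 1) (D.δ s) := by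
  induction m generalizing i with
  | zero =>
    cases i with
    | zero =>
      change D.σ s + D.δ 0 = D.σ s + 0
      rw [map_zero]
    | succ i =>
      change D.σ 0 + D.δ 0 = 0 + (0 : A)
      rw [map_zero, map_zero]
  | succ m ih =>
    rw [π_succ_succ, ih]
    cases i with
    | zero =>
      rw [π_succ_zero', π_succ_zero, π_succ_succ, map_add]
      abel
    | succ i =>
      rw [ih, π_succ_succ, π_succ_succ, map_add, map_add]
      abel

end OreDatum

/-! ### Leading terms, degree and nucleus -/

namespace OreExtension

open Finsupp

variable {K A : Type*} [CommRing K] [NonAssocRing A] [Module K A] {D : OreDatum K A}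

theorem coeff_eq_zero {f : OreExtension D} : f.coeff = 0 ↔ f = 0 :=
  ⟨fun h => OreExtension.ext h, fun h => by rw [h, coeff_zero]⟩

theorem coeff_mul_apply (f g : OreExtension D) (k : ℕ) : (f * g).coeff k =
    ∑ m ∈ f.coeff.support, ∑ n ∈ g.coeff.support, ∑ i ∈ Finset.range (m + 1),
      single (i + n) (f.coeff m * D.π m i (g.coeff n)) k := by
  rw [coeff_mul, Finsupp.sum, finsetSum_apply]
  refine Finset.sum_congr rfl fun m _ => ?_
  rw [Finsupp.sum, finsetSum_apply]
  exact Finset.sum_congr rfl fun n _ => finsetSum_apply _ _ _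

theorem topLE_mul {f g : OreExtension D} {m n : ℕ} (hf : f.coeff.TopLE m)
    (hg : g.coeff.TopLE n) : (f * g).coeff.TopLE (m + n) := by
  intro k hk
  rw [coeff_mul_apply]
  refine Finset.sum_eq_zero fun m' hm => Finset.sum_eq_zero fun n' hn =>
    Finset.sum_eq_zero fun i hi => single_eq_of_ne ?_
  have := hf.le_of_mem_support hm
  have := hg.le_of_mem_support hn
  have := Finset.mem_range.mp hi
  omega

/-- Only the summand `i = m` of the product of the top terms reaches `x^(m+n)`, and `π_m^m = σ^m`.
-/
theorem coeff_mul_add {f g : OreExtension D} {m n : ℕ} (hf : f.coeff.TopLE m)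
    (hg : g.coeff.TopLE n) :
    (f * g).coeff (m + n) = f.coeff m * D.σ^[m] (g.coeff n) := by
  rw [coeff_mul_apply, Finset.sum_eq_single m, Finset.sum_eq_single n, Finset.sum_eq_single m,
    single_eq_same, D.π_self]
  · intro i _ hne
    exact single_eq_of_ne (by omega)
  · intro h
    simp at h
  · intro j hj hne
    refine Finset.sum_eq_zero fun i hi => single_eq_of_ne ?_
    have := hg.le_of_mem_support hj
    have := Finset.mem_range.mp hi
    omega
  · intro h
    refine Finset.sum_eq_zero fun i hi => ?_
    rw [notMem_support_iff.mp h, map_zero, mul_zero, single_zero, coe_zero, Pi.zero_apply]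
  · intro m' hm hne
    refine Finset.sum_eq_zero fun j hj => Finset.sum_eq_zero fun i hi => single_eq_of_ne ?_
    have := hf.le_of_mem_support hm
    have := hg.le_of_mem_support hj
    have := Finset.mem_range.mp hi
    omega
  · intro h
    refine Finset.sum_eq_zero fun j _ => Finset.sum_eq_zero fun i _ => ?_
    rw [notMem_support_iff.mp h, zero_mul, single_zero, coe_zero, Pi.zero_apply]

theorem degree_eq_bot {f : OreExtension D} : degree f = ⊥ ↔ f = 0 :=
  sup_support_eq_bot.trans coeff_eq_zero

theorem degree_eq_of_isTop {f : OreExtension D} {n : ℕ} (h : f.coeff.IsTop n) :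
    degree f = ((n : ℤ) : WithBot ℤ) := h.sup_support

theorem exists_isTop {f : OreExtension D} (hf : f ≠ 0) : ∃ n, f.coeff.IsTop n :=
  Finsupp.exists_isTop (mt coeff_eq_zero.mp hf)

theorem isTop_mul [NoZeroDivisors A] (hσ : Function.Injective D.σ) {f g : OreExtension D}
    {m n : ℕ} (hf : f.coeff.IsTop m) (hg : g.coeff.IsTop n) :
    (f * g).coeff.IsTop (m + n) := by
  refine ⟨topLE_mul hf.1 hg.1, ?_⟩
  rw [coeff_mul_add hf.1 hg.1]
  refine mul_ne_zero hf.2 fun h => hg.2 (hσ.iterate m ?_)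
  rw [h, Function.iterate_fixed (map_zero D.σ)]

theorem isPseudoDegree_degree [NoZeroDivisors A] (hσ : Function.Injective D.σ) :
    IsPseudoDegree (degree (D := D)) where
  eq_bot_iff _ := degree_eq_bot
  map_mul f g := by
    rcases eq_or_ne f 0 with rfl | hf
    · rw [zero_mul, degree_eq_bot.mpr rfl, WithBot.bot_add]
    rcases eq_or_ne g 0 with rfl | hg
    · rw [mul_zero, degree_eq_bot.mpr rfl, WithBot.add_bot]
    obtain ⟨m, hm⟩ := exists_isTop hf
    obtain ⟨n, hn⟩ := exists_isTop hg
    rw [degree_eq_of_isTop hm, degree_eq_of_isTop hn, degree_eq_of_isTop (isTop_mul hσ hm hn)]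
    norm_cast
  map_add_le f g := by
    refine Finset.sup_le fun n hn => ?_
    rw [mem_support_iff, coeff_add, Finsupp.add_apply] at hn
    by_cases hf : f.coeff n = 0
    · rw [hf, zero_add] at hn
      exact le_max_of_le_right (Finset.le_sup (f := fun n : ℕ => ((n : ℤ) : WithBot ℤ))
        (mem_support_iff.mpr hn))
    · exact le_max_of_le_left (Finset.le_sup (f := fun n : ℕ => ((n : ℤ) : WithBot ℤ))
        (mem_support_iff.mpr hf))

variable (D) in
/-- The sequence of coefficients, linearly. -/
noncomputable def coeffEquiv : OreExtension D ≃ₗ[K] (ℕ →₀ A) :=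
  { equivFinsupp with
    map_add' := coeff_add
    map_smul' := coeff_smul }

variable (D) in
/-- The monomials `r xⁿ`, linearly in `r`. -/
noncomputable def mon (n : ℕ) : A →ₗ[K] OreExtension D :=
  (coeffEquiv D).symm.toLinearMap ∘ₗ lsingle n

theorem coeff_mon (n : ℕ) (r : A) : (mon D n r).coeff = single n r := rfl

theorem sum_mon (f : OreExtension D) : ∑ n ∈ f.coeff.support, mon D n (f.coeff n) = f := by
  refine (coeffEquiv D).injective ?_
  rw [map_sum]
  exact sum_single f.coeff

theorem induction_on {p : OreExtension D → Prop} (f : OreExtension D) (h0 : p 0)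
    (hadd : ∀ f g, p f → p g → p (f + g)) (hmon : ∀ n r, p (mon D n r)) : p f := by
  rw [← sum_mon f]
  exact Finset.sum_induction _ p hadd h0 fun n _ => hmon n _

/-- The free bound `N` costs nothing, as `π_i^m = 0` for `i > m`, and lets sums of different lengths
be aligned. -/
theorem mon_mul_mon_of_lt {m N : ℕ} (h : m < N) (n : ℕ) (r s : A) :
    mon D m r * mon D n s = ∑ i ∈ Finset.range N, mon D (i + n) (r * D.π m i s) := by
  have h1 : mon D m r * mon D n s =
      ∑ i ∈ Finset.range (m + 1), mon D (i + n) (r * D.π m i s) := by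
    refine (coeffEquiv D).injective ?_
    rw [map_sum]
    change (mon D m r * mon D n s).coeff = ∑ i ∈ Finset.range (m + 1), single (i + n) _
    rw [coeff_mul, coeff_mon, coeff_mon, sum_single_index (by simp), sum_single_index (by simp)]
  rw [h1]
  refine Finset.sum_subset (fun i hi => ?_) fun i _ hi => ?_
  · rw [Finset.mem_range] at hi ⊢
    omega
  · rw [D.π_of_lt (by simpa using hi), mul_zero, map_zero]

theorem mon_mul_X (m : ℕ) (r : A) : mon D m r * mon D 1 1 = mon D (m + 1) r := by
  rw [mon_mul_mon_of_lt m.lt_succ_self, Finset.sum_eq_single m]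
  · rw [D.π_one, if_pos rfl, mul_one]
  · intro i _ hi
    rw [D.π_one, if_neg hi, mul_zero, map_zero]
  · intro h
    simp at h

theorem X_mul_mon (n : ℕ) (s : A) :
    mon D 1 1 * mon D n s = mon D n (D.δ s) + mon D (n + 1) (D.σ s) := by
  rw [mon_mul_mon_of_lt (show 1 < 1 + 1 by omega), Finset.sum_range_succ _ 1, Finset.sum_range_one, one_mul, one_mul,
    D.π_self, zero_add, add_comm 1 n]
  rfl

/-- By additivity, monomials suffice. On the left the identity is the Leibniz rule and
multiplicativity of `σ`; in the middle it is the innermost-letter recursion for `π`; on the right,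
multiplication by `x` is a shift. Associativity of `A` plays no role. -/
theorem X_mem_nucleus : mon D 1 1 ∈ nucleus (OreExtension D) := by
  refine ⟨fun b c => ?_, fun b c => ?_, fun b c => ?_⟩
  · induction b using induction_on with
    | h0 => simp
    | hadd f g hf hg => rw [mul_add, add_mul, add_mul, mul_add, hf, hg]
    | hmon m r =>
    induction c using induction_on with
    | h0 => simp
    | hadd f g hf hg => rw [mul_add, mul_add, mul_add, hf, hg]
    | hmon n s =>
    rw [X_mul_mon, add_mul, mon_mul_mon_of_lt (show m < m + 1 by omega),
      mon_mul_mon_of_lt (show m + 1 < m + 2 by omega),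
      mon_mul_mon_of_lt (show m < m + 1 by omega) n r s, Finset.mul_sum]
    simp only [X_mul_mon, D.leibniz, map_add, map_mul, Finset.sum_add_distrib]
    -- Padding with the zero term `i = m + 1` gives this sum the range of the `π_i^(m+1)` sum;
    -- splitting off `i = 0` then matches the recursion.
    have h : ∑ i ∈ Finset.range (m + 1), mon D (i + n) (D.σ r * D.δ (D.π m i s)) =
        ∑ i ∈ Finset.range (m + 2), mon D (i + n) (D.σ r * D.δ (D.π m i s)) := by
      rw [Finset.sum_range_succ _ (m + 1), D.π_of_lt m.lt_succ_self, map_zero, mul_zero, map_zero,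
        add_zero]
    rw [h, Finset.sum_range_succ' _ (m + 1), Finset.sum_range_succ' _ (m + 1)]
    simp only [D.π_succ_succ, D.π_succ_zero, mul_add, map_add, Finset.sum_add_distrib,
      add_right_comm _ n 1]
    abel
  · induction b using induction_on with
    | h0 => simp
    | hadd f g hf hg => rw [add_mul, add_mul, add_mul, hf, hg]
    | hmon m r =>
    induction c using induction_on with
    | h0 => simp
    | hadd f g hf hg => rw [mul_add, mul_add, mul_add, hf, hg]
    | hmon n s =>
    rw [mon_mul_X, X_mul_mon, mul_add, mon_mul_mon_of_lt (show m < m + 2 by omega),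
      mon_mul_mon_of_lt (show m < m + 1 by omega), mon_mul_mon_of_lt (show m + 1 < m + 2 by omega),
      Finset.sum_range_succ' _ (m + 1), Finset.sum_range_succ' _ (m + 1)]
    simp only [D.π_succ_succ', D.π_succ_zero', mul_add, map_add, Finset.sum_add_distrib]
    simp only [add_assoc, add_comm 1 n]
    abel
  · induction b using induction_on with
    | h0 => simp
    | hadd f g hf hg => rw [add_mul, add_mul, add_mul, hf, hg]
    | hmon m r =>
    induction c using induction_on with
    | h0 => simp
    | hadd f g hf hg => rw [mul_add, add_mul, add_mul, mul_add, hf, hg]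
    | hmon n s =>
    rw [mon_mul_X, mon_mul_mon_of_lt m.lt_succ_self, mon_mul_mon_of_lt m.lt_succ_self,
      Finset.sum_mul]
    simp only [mon_mul_X, add_assoc]

theorem mon_one_mem_nucleus (n : ℕ) : mon D n 1 ∈ nucleus (OreExtension D) := by
  induction n with
  | zero => exact (nucleus (OreExtension D)).one_mem
  | succ n ih =>
    rw [← mon_mul_X]
    exact (nucleus (OreExtension D)).mul_mem ih X_mem_nucleus

/-- Polynomials in `x` with coefficients in the scalars lie in the nucleus. -/
theorem mem_nucleus_of_coeff_eq_smul_one [IsScalarTower K A A] [SMulCommClass K A A]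
    {f : OreExtension D} (hf : ∀ n, ∃ c : K, f.coeff n = c • (1 : A)) :
    f ∈ nucleus (OreExtension D) := by
  rw [← sum_mon f]
  refine sum_mem fun n _ => ?_
  obtain ⟨c, hc⟩ := hf n
  rw [hc, map_smul]
  exact (c • (⟨mon D n 1, mon_one_mem_nucleus n⟩ : nucleus (OreExtension D))).2

theorem mem_centralizer_singleton {a b : OreExtension D} :
    b ∈ Set.centralizer {a} ↔ a * b = b * a := by
  simp [Set.mem_centralizer_iff]

/-- The leading coefficient of an element commuting with `a` is fixed by a power of `σ`, when the
leading coefficient of `a` is a non-zero scalar. -/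
theorem σ_iterate_eq_of_mem_centralizer {F : Type*} [Field F] [Module F A] [IsScalarTower F A A]
    [SMulCommClass F A A] {D : OreDatum F A} {a b : OreExtension D} {m n : ℕ} {c : F}
    (ha : a.coeff.TopLE m) (hc : a.coeff m = c • (1 : A)) (hc0 : c ≠ 0)
    (hb : b.coeff.TopLE n) (hab : b ∈ Set.centralizer {a}) :
    D.σ^[m] (b.coeff n) = b.coeff n := by
  -- The coefficient at `x^(m+n)` is `c σ^m(b_n)` in `ab` and `b_n σ^n(c) = c b_n` in `ba`.
  have h1 := coeff_mul_add ha hb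
  rw [mem_centralizer_singleton.mp hab, add_comm m n, coeff_mul_add hb ha, hc] at h1
  have h2 : D.σ^[n] (c • (1 : A)) = c • (1 : A) :=
    Function.iterate_fixed (by rw [map_smul, D.map_one]) n
  rw [h2, mul_smul_comm, mul_one, smul_mul_assoc, one_mul] at h1
  exact (smul_right_injective A hc0 h1).symm

end OreExtension

/-! ## Centralizers in Ore extensions -/

instance {K S : Type*} [CommRing K] [NonAssocRing S] [Module K S] [IsScalarTower K S S]
    [SMulCommClass K S S] (a : nucleus S) : IsScalarTower K (polyAlg K a) S :=
  ⟨fun c p s => smul_mul_assoc c p.1.1 s⟩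

/-- The centralizer is torsion-free over `K[a]`, hence free when it is finitely generated. -/
theorem free_centralizerModule {K S : Type*} [Field K] [NonAssocRing S] [Module K S]
    [IsScalarTower K S S] [SMulCommClass K S S] [NoZeroDivisors S] [Nontrivial S] (a : nucleus S)
    (hfin : Module.Finite (polyAlg K a) (centralizerModule K a)) :
    Module.Free (polyAlg K a) (centralizerModule K a) := by
  -- One generator makes the ring commutative; the existing ring structure is kept so that the
  -- module structure still applies.
  let _ : CommRing (polyAlg K a) :=
    { (inferInstance : Ring (polyAlg K a)) with
      mul_comm := fun p q => Subtype.ext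
        (Algebra.commute_of_mem_adjoin_singleton_of_commute (R := K) (b := a) q.2
          (Algebra.commute_of_mem_adjoin_self p.2).symm).eq }
  have : NoZeroDivisors (polyAlg K a) :=
    ⟨fun {p q} h => (mul_eq_zero.mp (congrArg (fun x : polyAlg K a => x.1.1) h)).imp
      (fun h => Subtype.ext (Subtype.ext h)) fun h => Subtype.ext (Subtype.ext h)⟩
  have : Nontrivial (polyAlg K a) :=
    ⟨0, 1, fun h => zero_ne_one (congrArg (fun x : polyAlg K a => x.1.1) h)⟩
  have : IsDomain (polyAlg K a) := NoZeroDivisors.to_isDomain _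
  -- `K[a]` is a quotient of `K[X]` by evaluation at `a`.
  have : IsPrincipalIdealRing (polyAlg K a) := by
    let x : polyAlg K a := ⟨a, Algebra.self_mem_adjoin_singleton K a⟩
    refine IsPrincipalIdealRing.of_surjective (Polynomial.aeval x : Polynomial K →ₐ[K] _) ?_
    rintro ⟨p, hp⟩
    obtain ⟨f, hf⟩ := (Algebra.adjoin_singleton_eq_range_aeval K a).le hp
    refine ⟨f, Subtype.ext ?_⟩
    exact (Polynomial.aeval_algHom_apply (polyAlg K a).val x f).symm.trans hf
  have : Module.IsTorsionFree (polyAlg K a) (centralizerModule K a) :=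
    .of_smul_eq_zero fun p s h => (mul_eq_zero.mp (congrArg Subtype.val h)).imp
      (fun h => Subtype.ext (Subtype.ext h)) fun h => Subtype.ext h
  exact Module.free_of_finite_type_torsion_free'

/-! ### Centralizers filtered by degree, and their leading coefficients -/

namespace OreExtension

open Finsupp

section Domain

variable {K A : Type*} [CommRing K] [NonAssocRing A] [Module K A] {D : OreDatum K A}

theorem noZeroDivisors [NoZeroDivisors A] (hσ : Function.Injective D.σ) :
    NoZeroDivisors (OreExtension D) where
  eq_zero_or_eq_zero_of_mul_eq_zero {f g} h := by
    by_contra! hfg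
    obtain ⟨m, hm⟩ := exists_isTop hfg.1
    obtain ⟨n, hn⟩ := exists_isTop hfg.2
    exact (isTop_mul hσ hm hn).ne_zero (by rw [h, coeff_zero])

instance [Nontrivial A] : Nontrivial (OreExtension D) :=
  ⟨0, 1, fun h => one_ne_zero (single_eq_zero.mp (congrArg coeff h).symm)⟩

variable (D) in
/-- The coefficient of `xⁿ`, linearly. -/
noncomputable def lcoeff (n : ℕ) : OreExtension D →ₗ[K] A :=
  lapply n ∘ₗ (coeffEquiv D).toLinearMap

theorem lcoeff_apply (n : ℕ) (f : OreExtension D) : lcoeff D n f = f.coeff n := rfl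

variable [IsScalarTower K A A] [SMulCommClass K A A]

/-- The elements of degree less than `q` of the centralizer of `a`. -/
noncomputable def centralizerLT (a : OreExtension D) (q : ℕ) :
    Submodule K (OreExtension D) where
  carrier := {b | b ∈ Set.centralizer {a} ∧ ∀ k, q ≤ k → b.coeff k = 0}
  add_mem' := fun {b b'} h h' => ⟨Set.add_mem_centralizer h.1 h'.1, fun k hk => by
    rw [coeff_add, Finsupp.add_apply, h.2 k hk, h'.2 k hk, add_zero]⟩
  zero_mem' := ⟨Set.zero_mem_centralizer, fun _ _ => rfl⟩
  smul_mem' := fun c b h => ⟨by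
    have h1 := mem_centralizer_singleton.mp h.1
    rw [mem_centralizer_singleton, mul_smul_comm, h1, smul_mul_assoc], fun k hk => by
    rw [coeff_smul, Finsupp.smul_apply, h.2 k hk, smul_zero]⟩

theorem centralizerLT_mono (a : OreExtension D) : Monotone (centralizerLT a) :=
  fun _ _ h _ hb => ⟨hb.1, fun k hk => hb.2 k (h.trans hk)⟩

theorem exists_mem_centralizerLT {a b : OreExtension D} (hb : b ∈ Set.centralizer {a}) :
    ∃ q, b ∈ centralizerLT a q := by
  rcases eq_or_ne b 0 with rfl | h0
  · exact ⟨0, zero_mem _⟩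
  · obtain ⟨n, hn⟩ := exists_isTop h0
    exact ⟨n + 1, hb, hn.1⟩

theorem mem_centralizerLT_of_coeff_eq_zero {a b : OreExtension D} {q : ℕ}
    (hb : b ∈ centralizerLT a (q + 1)) (h0 : b.coeff q = 0) : b ∈ centralizerLT a q := by
  refine ⟨hb.1, fun k hk => ?_⟩
  rcases hk.eq_or_lt with rfl | hk
  · exact h0
  · exact hb.2 k hk

/-- The coefficients at `x^q` of the elements of degree at most `q` of the centralizer of `a`. -/
noncomputable def leadCoeffs (a : OreExtension D) (q : ℕ) : Submodule K A :=
  (centralizerLT a (q + 1)).map (lcoeff D q)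

theorem mem_leadCoeffs {a : OreExtension D} {q : ℕ} {r : A} : r ∈ leadCoeffs a q ↔
    ∃ b ∈ centralizerLT a (q + 1), b.coeff q = r := Submodule.mem_map

end Domain

/-! ### Condition `D(ℓ)` and finiteness when `σ^m` has few fixed points -/

section Field

variable {K A : Type*} [Field K] [NonAssocRing A] [Module K A] [IsScalarTower K A A]
  [SMulCommClass K A A] {D : OreDatum K A} {a : OreExtension D} {m : ℕ} {c : K}
  (ha : a.coeff.TopLE m) (hc : a.coeff m = c • (1 : A)) (hc0 : c ≠ 0)
  {V : Submodule K A} (hV : ∀ s, D.σ^[m] s = s → s ∈ V)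

include ha hc hc0

section LeadCoeffs

include hV

theorem leadCoeffs_le (q : ℕ) : leadCoeffs a q ≤ V := by
  intro r hr
  obtain ⟨b, hb, rfl⟩ := mem_leadCoeffs.mp hr
  exact hV _ (σ_iterate_eq_of_mem_centralizer ha hc hc0 hb.2 hb.1)

/-- A linear relation among the leading coefficients, which all lie in `V`, cancels the common top
degree. -/
theorem conditionD_centralizer [FiniteDimensional K V] {ℓ : ℕ} (hℓ : Module.finrank K V ≤ ℓ) :
    ConditionD K (degree (D := D)) ℓ (Set.centralizer {a}) := by
  refine ⟨fun b _ hb => ?_, fun b hb ⟨q, hq⟩ => ?_⟩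
  · obtain ⟨n, hn⟩ := exists_isTop hb
    rw [degree_eq_of_isTop hn]
    exact WithBot.coe_le_coe.mpr (Int.natCast_nonneg n)
  · obtain ⟨n, rfl, -⟩ := isTop_of_sup_support (hq 0)
    have htop : ∀ i, (b i).coeff.TopLE n := fun i => by
      obtain ⟨n', h1, h2⟩ := isTop_of_sup_support (hq i)
      rw [Int.ofNat_inj.mp h1]
      exact h2.1
    let v : Fin (ℓ + 1) → V := fun i =>
      ⟨(b i).coeff n, hV _ (σ_iterate_eq_of_mem_centralizer ha hc hc0 (htop i) (hb i))⟩
    have hdep : ¬LinearIndependent K v := fun h => by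
      have := h.fintype_card_le_finrank
      rw [Fintype.card_fin] at this
      omega
    obtain ⟨α, hα, i, hi⟩ := Fintype.not_linearIndependent_iff.mp hdep
    refine ⟨α, fun h => hi (congrFun h i), ?_⟩
    rw [hq 0]
    have hcoeff : ∀ k, (∑ i, α i • b i).coeff k = ∑ i, α i • (b i).coeff k := fun k => by
      rw [← lcoeff_apply, map_sum]
      exact Finset.sum_congr rfl fun i _ => map_smul _ _ _
    refine sup_support_lt (fun k hk => ?_) ?_
    · rw [hcoeff]
      exact Finset.sum_eq_zero fun i _ => by rw [htop i k hk, smul_zero]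
    · rw [hcoeff]
      simpa [v] using congrArg V.subtype hα

/-- Each further degree enlarges the space by at most a subspace of `V`. -/
theorem fg_centralizerLT [FiniteDimensional K V] (q : ℕ) : (centralizerLT a q).FG := by
  induction q with
  | zero =>
    have h : centralizerLT a 0 = ⊥ := (Submodule.eq_bot_iff _).mpr fun b hb =>
      coeff_eq_zero.mp (Finsupp.ext fun k => hb.2 k k.zero_le)
    rw [h]
    exact Submodule.fg_bot
  | succ q ih =>
    refine Submodule.fg_of_fg_map_of_fg_inf_ker (lcoeff D q) ?_ ?_
    · have h := Submodule.finiteDimensional_of_le (leadCoeffs_le ha hc hc0 hV q)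
      exact Module.Finite.iff_fg.mp h
    · have h : centralizerLT a (q + 1) ⊓ LinearMap.ker (lcoeff D q) = centralizerLT a q :=
        le_antisymm (fun b hb => mem_centralizerLT_of_coeff_eq_zero hb.1 hb.2)
          fun b hb => ⟨centralizerLT_mono a q.le_succ hb, hb.2 q le_rfl⟩
      rwa [h]

end LeadCoeffs

variable (hnuc : a ∈ nucleus (OreExtension D))

include hnuc

omit hc hc0 in
theorem mul_mem_centralizerLT {b : OreExtension D} {q : ℕ} (hb : b ∈ centralizerLT a (q + 1)) :
    a * b ∈ centralizerLT a (q + m + 1) := by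
  refine ⟨?_, fun k hk => topLE_mul ha hb.2 k (by omega)⟩
  rw [mem_centralizer_singleton, hnuc.1, ← mem_centralizer_singleton.mp hb.1]

omit hnuc in
theorem coeff_mul_of_mem_centralizerLT {b : OreExtension D} {q : ℕ}
    (hb : b ∈ centralizerLT a (q + 1)) : (a * b).coeff (q + m) = c • b.coeff q := by
  rw [add_comm q m, coeff_mul_add ha hb.2, hc,
    σ_iterate_eq_of_mem_centralizer ha hc hc0 hb.2 hb.1, smul_mul_assoc, one_mul]

/-- Multiplication by `c⁻¹ a` raises the degree by `m` and keeps the leading coefficient, which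
`σ^m` fixes. -/
theorem leadCoeffs_le_leadCoeffs_add (q : ℕ) : leadCoeffs a q ≤ leadCoeffs a (q + m) := by
  intro r hr
  obtain ⟨b, hb, rfl⟩ := mem_leadCoeffs.mp hr
  refine mem_leadCoeffs.mpr ⟨c⁻¹ • (a * b), Submodule.smul_mem _ _
    (mul_mem_centralizerLT ha hnuc hb), ?_⟩
  rw [coeff_smul, Finsupp.smul_apply, coeff_mul_of_mem_centralizerLT ha hc hc0 hb,
    inv_smul_smul₀ hc0]

include hV

/-- The spaces of leading coefficients are eventually periodic. -/
theorem exists_leadCoeffs_add_le [FiniteDimensional K V] (hm : 0 < m) :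
    ∃ N, ∀ q, N ≤ q → leadCoeffs a (q + m) ≤ leadCoeffs a q := by
  have hstab : ∀ r, ∃ n, ∀ k, n ≤ k → leadCoeffs a (r + k * m + m) ≤ leadCoeffs a (r + k * m) := by
    intro r
    -- The ascending chain along the residue class of `r` modulo `m`, inside the Noetherian space
    -- `V`.
    let F : ℕ →o Submodule K V :=
      ⟨fun k => (leadCoeffs a (r + k * m)).comap V.subtype, monotone_nat_of_le_succ fun k =>
        Submodule.comap_mono (by
          rw [Nat.succ_mul, ← add_assoc]
          exact leadCoeffs_le_leadCoeffs_add ha hc hc0 hnuc _)⟩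
    obtain ⟨n, hn⟩ := monotone_stabilizes_iff_noetherian.mpr inferInstance F
    refine ⟨n, fun k hk s hs => ?_⟩
    have h : F (k + 1) = F k := (hn (k + 1) (by omega)).symm.trans (hn k hk)
    have hs' : (⟨s, leadCoeffs_le ha hc hc0 hV _ hs⟩ : V) ∈ F (k + 1) := by
      change s ∈ leadCoeffs a (r + (k + 1) * m)
      rwa [Nat.succ_mul, ← add_assoc]
    rw [h] at hs'
    exact hs'
  choose n hn using hstab
  -- Large enough that `q / m` exceeds the stabilization index of every residue class.
  refine ⟨(Finset.range m).sup n * m + m, fun q hq => ?_⟩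
  have hr : q % m < m := Nat.mod_lt q hm
  have hle : n (q % m) ≤ (Finset.range m).sup n := Finset.le_sup (Finset.mem_range.mpr hr)
  have hk : n (q % m) ≤ q / m := by
    rw [Nat.le_div_iff_mul_le hm]
    nlinarith
  have h := hn _ _ hk
  rwa [Nat.mod_add_div' q m] at h

/-- Division by `a`: from degree `N + m` on, a leading term is cancelled by `a * b'` with `b'` in
the centralizer, so the elements of degree below `N + m` generate. -/
theorem finite_centralizerModule [FiniteDimensional K V] (hm : 0 < m) :
    Module.Finite (polyAlg K (⟨a, hnuc⟩ : nucleus (OreExtension D)))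
      (centralizerModule K (⟨a, hnuc⟩ : nucleus (OreExtension D))) := by
  obtain ⟨N, hN⟩ := exists_leadCoeffs_add_le ha hc hc0 hV hnuc hm
  set a' : nucleus (OreExtension D) := ⟨a, hnuc⟩
  obtain ⟨T, hT⟩ := fg_centralizerLT ha hc hc0 hV (N + m)
  rw [Module.Finite.iff_fg]
  have hspan : ∀ b ∈ centralizerLT a (N + m),
      b ∈ Submodule.span (polyAlg K a') (T : Set (OreExtension D)) := fun b hb => by
    rw [← hT] at hb
    exact Submodule.span_le_restrictScalars K _ _ hb
  refine ⟨T, le_antisymm (Submodule.span_le.mpr fun b hb => ?_) fun b hb => ?_⟩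
  · exact (hT.le (Submodule.subset_span hb)).1
  · obtain ⟨q, hq⟩ := exists_mem_centralizerLT hb
    clear hb
    induction q generalizing b with
    | zero => exact hspan b (centralizerLT_mono a (Nat.zero_le _) hq)
    | succ q ih =>
      rcases Nat.lt_or_ge q (N + m) with hlt | hge
      · exact hspan b (centralizerLT_mono a hlt hq)
      · obtain ⟨p, rfl⟩ := Nat.exists_eq_add_of_le' (show m ≤ q by omega)
        -- The factor `c⁻¹` makes `a * b'` have exactly the coefficient of `b` at `x^(p+m)`.
        obtain ⟨b', hb', hlead⟩ := mem_leadCoeffs.mp (hN p (by omega)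
          (Submodule.smul_mem _ c⁻¹ (mem_leadCoeffs.mpr ⟨b, hq, rfl⟩)))
        -- Since `m > 0`, `b'` has smaller degree than the current bound, so induction covers it as
        -- well as the remainder `b - a * b'`.
        have h1 : b' ∈ Submodule.span (polyAlg K a') (T : Set (OreExtension D)) :=
          ih b' (centralizerLT_mono a (by omega) hb')
        have h2 : a * b' ∈ Submodule.span (polyAlg K a') (T : Set (OreExtension D)) :=
          Submodule.smul_mem _
            (⟨a', Algebra.self_mem_adjoin_singleton K a'⟩ : polyAlg K a') h1
        have h3 : b - a * b' ∈ centralizerLT a (p + m) := by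
          refine mem_centralizerLT_of_coeff_eq_zero
            (sub_mem hq (mul_mem_centralizerLT ha hnuc hb')) ?_
          rw [← lcoeff_apply, map_sub, lcoeff_apply, lcoeff_apply,
            coeff_mul_of_mem_centralizerLT ha hc hc0 hb', hlead, smul_inv_smul₀ hc0, sub_self]
        rw [← sub_add_cancel b (a * b')]
        exact add_mem (ih _ h3) h2

end Field

end OreExtension

/-! ### The theorem for octonion polynomials -/

theorem mainTheorem4
    -- an `ℝ`-algebra endomorphism `σ` of `𝕆[y]` and an `ℝ`-linear `σ`-derivation `δ`
    (D : OreDatum ℝ (NAPoly Octonion))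
    (hσ : 1 < NAPoly.degree (D.σ NAPoly.Y))
    -- `a ∈ S = 𝕆[y][x; σ, δ]` of positive degree in `x`, with real coefficients
    (a : OreExtension D)
    (hpos : 0 < OreExtension.degree a)
    (hreal : ∀ n, ∃ c : ℝ, OreExtension.coeff a n = c • (1 : NAPoly Octonion)) :
    IsPseudoDegree (OreExtension.degree (D := D)) ∧
    ConditionD ℝ (OreExtension.degree (D := D)) 8 (Set.centralizer {a}) ∧
    ∃ ha : a ∈ nucleus (OreExtension D),
      Module.Free (polyAlg ℝ (⟨a, ha⟩ : nucleus (OreExtension D)))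
        (centralizerModule ℝ (⟨a, ha⟩ : nucleus (OreExtension D))) ∧
      Module.Finite (polyAlg ℝ (⟨a, ha⟩ : nucleus (OreExtension D)))
        (centralizerModule ℝ (⟨a, ha⟩ : nucleus (OreExtension D))) := by
  obtain ⟨d, hd⟩ : ∃ d, (D.σ NAPoly.Y).coeff.IsTop d := by
    refine Finsupp.exists_isTop fun h => ?_
    rw [NAPoly.degree, Finsupp.sup_support_eq_bot.mpr h] at hσ
    exact not_lt_bot hσ
  have hd1 : 1 < d := by
    rw [NAPoly.degree, hd.sup_support] at hσ
    exact_mod_cast hσ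
  have hinj := OreDatum.σ_injective hd (by omega)
  obtain ⟨m, hm⟩ : ∃ m, a.coeff.IsTop m := by
    refine OreExtension.exists_isTop fun h => ?_
    rw [OreExtension.degree_eq_bot.mpr h] at hpos
    exact not_lt_bot hpos
  have hm0 : 0 < m := by
    rw [OreExtension.degree_eq_of_isTop hm] at hpos
    exact_mod_cast hpos
  obtain ⟨c, hc⟩ := hreal m
  have hc0 : c ≠ 0 := by
    rintro rfl
    exact hm.2 (by rw [hc, zero_smul])
  -- Here `V` is the copy of `𝕆` in `𝕆[y]`; its dimension is the source of the 8.
  have hV : ∀ s, D.σ^[m] s = s → s ∈ LinearMap.range (NAPoly.constant ℝ (R := Octonion)) :=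
    fun s hs => ⟨s.coeff 0, (NAPoly.eq_monomial_of_topLE_zero
      (OreDatum.topLE_zero_of_σ_iterate_eq hd hd1 hm0 hs)).symm⟩
  have hrank : Module.finrank ℝ (LinearMap.range (NAPoly.constant ℝ (R := Octonion))) ≤ 8 :=
    Octonion.finrank_eq ▸ LinearMap.finrank_range_le _
  have hnuc := OreExtension.mem_nucleus_of_coeff_eq_smul_one hreal
  have hfin := OreExtension.finite_centralizerModule hm.1 hc hc0 hV hnuc hm0
  have := OreExtension.noZeroDivisors hinj
  exact ⟨OreExtension.isPseudoDegree_degree hinj,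
    OreExtension.conditionD_centralizer hm.1 hc hc0 hV hrank, hnuc,
    free_centralizerModule _ hfin, hfin⟩
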